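/- All varieties are over $\mathbb{C}$ and carry the Zariski topology. Let $X\subset\mathbb{P}^3$ be an irreducible closed algebraic curve, let $M_1,M_2$ be $3\times4$ matrices of rank $3$, regarded as projections $\mathbb{P}^3\dashrightarrow\mathbb{P}^2$ whose centers do not lie on $X$, and suppose that $Y_i=M_i(X)\subset\mathbb{P}^2$ is an irreducible plane curve ($i=1,2$). Let $Y_i^\star$ be the dual curve of $Y_i$, i.e. the closure of the set of tangent lines at smooth points of $Y_i$, and suppose that $Y_1^\star$ and $Y_2^\star$ are curves of the same degree $m$ (the common class of $Y_1$ and $Y_2$; this is the case for generic centers of projection), defined by irreducible forms $\phi_1,\phi_2$ of degree $m$. For $(e_1,F,e_2)\in\mathbb{P}^2\times\mathbb{P}^8\times\mathbb{P}^2$, where points of $\mathbb{P}^8$ are regarded as nonzero $3\times3$ matrices up to scalars, consider the generalized Kruppa equation $$\phi_2(Fp)=\lambda\,\phi_1(e_1\times p)\qquad\text{(identically in } p\in\mathbb{C}^3),$$ and let $\{E_i(F,e_1)\}_i$ be the bihomogeneous equations obtained from it by eliminating $\lambda$, namely the vanishing of all $2\times2$ minors of the two-row matrix whose rows are the coefficient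 vectors of the polynomials $\phi_2(Fp)$ and $\phi_1(e_1\times p)$ in $p$. Let $V\subset\mathbb{P}^2\times\mathbb{P}^8\times\mathbb{P}^2$ be the variety defined by the equations $E_i(F,e_1)$ together with $Fe_1=0$ and $e_2^TF=0$. If $V$ is nonempty, then $\dim V\ge 7-m$. Likewise, if the set $V^\circ\subset V$ of those triples for which the Kruppa equation holds with some nonzero scalar $\lambda$ is nonempty, then $\dim V^\circ\ge 7-m$. -/

import Mathlib

open MvPolynomial

namespace Kruppa

/-- The projective space `ℙ(ℂ^ι)` of lines of `ℂ^ι`, carrying the Zariski topology. -/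
def PSpace (ι : Type) : Type := Projectivization ℂ (ι → ℂ)

/-- The projective plane `ℙ²`. -/
abbrev P2 : Type := PSpace (Fin 3)

/-- Projective space `ℙ³`. -/
abbrev P3 : Type := PSpace (Fin 4)

/-- The projective space `ℙ⁸` of `3 × 3` matrices modulo scalars. -/
abbrev P8 : Type := PSpace (Fin 3 × Fin 3)

/-- A vector of homogeneous coordinates of a point. -/
noncomputable def PSpace.coords {ι : Type} (P : PSpace ι) : ι → ℂ := Projectivization.rep P

/-- The point with homogeneous coordinates `v ≠ 0`. -/
noncomputable def PSpace.mk {ι : Type} (v : ι → ℂ) (hv : v ≠ 0) : PSpace ι := Projectivization.mk ℂ v hv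

/-- The matrix (well defined up to a non-zero scalar) represented by a point of `ℙ⁸`. -/
noncomputable def P8.matrix (F : P8) : Matrix (Fin 3) (Fin 3) ℂ :=
  Matrix.of fun i j => F.coords (i, j)

/-- The Zariski topology of a projective space: the sets `{g ≠ 0}`, for `g` homogeneous, are a
basis of open sets, so the closed sets are the zero loci of families of homogeneous polynomials. -/
instance PSpace.zariski (ι : Type) : TopologicalSpace (PSpace ι) :=
  TopologicalSpace.generateFrom
    {U | ∃ (g : MvPolynomial ι ℂ) (k : ℕ), g.IsHomogeneous k ∧ U = {P | eval P.coords g ≠ 0}}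

/-- The product `ℙ² × ℙ⁸ × ℙ²`, the space of triples `(e₁, F, e₂)`. -/
structure Triple : Type where
  /-- the first epipole -/
  e₁ : P2
  /-- the fundamental matrix -/
  F : P8
  /-- the second epipole -/
  e₂ : P2

/-- The coordinate ring of `ℙ² × ℙ⁸ × ℙ²` has one variable for each coordinate of each factor. -/
abbrev TripleVar : Type := Fin 3 ⊕ (Fin 3 × Fin 3) ⊕ Fin 3

/-- The multidegree of each variable. -/
def TripleVar.weight : TripleVar → ℕ × ℕ × ℕ
  | Sum.inl _ => (1, 0, 0)
  | Sum.inr (Sum.inl _) => (0, 1, 0)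
  | Sum.inr (Sum.inr _) => (0, 0, 1)

/-- Multihomogeneous coordinates of a triple. -/
noncomputable def Triple.coords (t : Triple) : TripleVar → ℂ :=
  Sum.elim t.e₁.coords (Sum.elim t.F.coords t.e₂.coords)

/-- The Zariski topology of the projective variety `ℙ² × ℙ⁸ × ℙ²`: the sets `{g ≠ 0}`, for `g`
multihomogeneous, are a basis of open sets. -/
instance Triple.zariski : TopologicalSpace Triple :=
  TopologicalSpace.generateFrom
    {U | ∃ (g : MvPolynomial TripleVar ℂ) (k : ℕ × ℕ × ℕ),
      IsWeightedHomogeneous TripleVar.weight g k ∧ U = {t | eval t.coords g ≠ 0}}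

/-- `X ⊆ ℙ³` is an irreducible closed algebraic curve. -/
def IsSpaceCurve (X : Set P3) : Prop :=
  IsClosed X ∧ IsIrreducible X ∧ topologicalKrullDim X = 1

/-- The image of `X ⊆ ℙ³` under the projection `P ↦ M P` (undefined at the centre, the kernel
of `M`). -/
def projection (M : Matrix (Fin 3) (Fin 4) ℂ) (X : Set P3) : Set P2 :=
  {Q | ∃ P ∈ X, ∃ h : M.mulVec P.coords ≠ 0, Q = PSpace.mk (M.mulVec P.coords) h}

/-- `f` is a form of degree `k` defining the irreducible plane curve `C`: an irreducible form
whose zero locus is `C`. -/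
def IsEquation (f : MvPolynomial (Fin 3) ℂ) (k : ℕ) (C : Set P2) : Prop :=
  f.IsHomogeneous k ∧ Irreducible f ∧ C = {P | eval P.coords f = 0}

/-- The gradient of `f` at `v`. At a smooth point of the curve `f = 0` it is the vector of
coordinates of the tangent line. -/
noncomputable def grad (f : MvPolynomial (Fin 3) ℂ) (v : Fin 3 → ℂ) : Fin 3 → ℂ :=
  fun i => eval v (pderiv i f)

/-- The dual of the plane curve `f = 0` (`f` an irreducible form): the Zariski closure, in the dual
plane, of the set of the tangent lines at the smooth points of the curve. -/
def dualCurve (f : MvPolynomial (Fin 3) ℂ) : Set P2 :=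
  closure {L | ∃ P : P2, eval P.coords f = 0 ∧
    ∃ h : grad f P.coords ≠ 0, L = PSpace.mk (grad f P.coords) h}

/-- The polynomial `φ(F p)` in the coordinates of `p`. -/
noncomputable def compXi (φ : MvPolynomial (Fin 3) ℂ) (F : Matrix (Fin 3) (Fin 3) ℂ) :
    MvPolynomial (Fin 3) ℂ :=
  bind₁ (fun i => ∑ j, C (F i j) * X j) φ

/-- The polynomial `φ(e × p)` in the coordinates of `p`; the cross product `e × p` is the vector
of coordinates of the line joining `e` and `p`. -/
noncomputable def compGamma (φ : MvPolynomial (Fin 3) ℂ) (e : Fin 3 → ℂ) :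
    MvPolynomial (Fin 3) ℂ :=
  bind₁ (crossProduct (fun i => C (e i)) (fun i => X i)) φ

/-- `F e₁ = 0` and `e₂ᵀ F = 0`. -/
def IsEpipolar (t : Triple) : Prop :=
  t.F.matrix.mulVec t.e₁.coords = 0 ∧ Matrix.vecMul t.e₂.coords t.F.matrix = 0

/-- The equations on `(e₁, F)` obtained from `φ₂(F p) = λ φ₁(e₁ × p)` (an identity of polynomials
in `p`) by eliminating the scalar `λ`: the two vectors of coefficients are proportional, i.e. the
`2 × 2` minors of the two-row matrix that they form vanish. -/
def KruppaEquations (φ₁ φ₂ : MvPolynomial (Fin 3) ℂ) (t : Triple) : Prop :=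
  ∀ α β : Fin 3 →₀ ℕ,
    coeff α (compXi φ₂ t.F.matrix) * coeff β (compGamma φ₁ t.e₁.coords) =
      coeff β (compXi φ₂ t.F.matrix) * coeff α (compGamma φ₁ t.e₁.coords)

/-- The variety `V ⊆ ℙ² × ℙ⁸ × ℙ²`. -/
def kruppaVariety (φ₁ φ₂ : MvPolynomial (Fin 3) ℂ) : Set Triple :=
  {t | KruppaEquations φ₁ φ₂ t ∧ IsEpipolar t}

/-- The part of `V` where the Kruppa equation holds with a non-zero scalar `λ`. -/
def kruppaSolutions (φ₁ φ₂ : MvPolynomial (Fin 3) ℂ) : Set Triple :=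
  {t | (∃ c : ℂ, c ≠ 0 ∧ compXi φ₂ t.F.matrix = C c * compGamma φ₁ t.e₁.coords) ∧ IsEpipolar t}

end Kruppa

/-!
The product `ℙ² × ℙ⁸ × ℙ²` is covered by affine charts of dimension 12. Near a solution at which
`φ₁(e₁ × p)` is not identically zero, the solutions are cut out by `5 + m` equations: the three of
`F e₁ = 0`, two of `e₂ᵀ F = 0` (the third follows, as `(e₂ᵀ F) e₁ = 0`), and `m` that express the
Kruppa equation. Indeed `φ₂(F p)` and `φ₁(e₁ × p)` do not change when a multiple of `e₁` is added
to `p`, so they are binary forms of degree `m` on the pencil of lines through `e₁`, and they are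
proportional as soon as their values at `m + 1` points of a line not through `e₁` are; at one of
these points `φ₁(e₁ × p)` is not zero, and `m` equations compare the others with it. By
Krull's height theorem a component of the solution set has dimension at least
`12 - (5 + m) = 7 - m`.

If `φ₁(e₁ × p)` is identically zero, then `φ₁` vanishes on a line and, being irreducible, is linear.
In this case `m = 1`, and there is an explicit solution, with `F` of rank one, for which neither
side of the Kruppa equation is zero.
-/

namespace Kruppa

open scoped Matrix

section CommutativeAlgebra

theorem height_eq_krullDim_Iic {R : Type*} [CommRing R] (p : PrimeSpectrum R) :
    (p.asIdeal.height : WithBot ℕ∞) = Order.krullDim (Set.Iic p) := by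
  rw [← Order.height_eq_krullDim_Iic, PrimeSpectrum.height_eq_orderHeight]

theorem height_le_krullDim_add_encard {R : Type*} [CommRing R] [IsNoetherianRing R]
    (s : Set R) (p : PrimeSpectrum R) (hs : s ⊆ p.asIdeal) :
    (p.asIdeal.height : WithBot ℕ∞) ≤
      Order.krullDim {q : PrimeSpectrum R // s ⊆ q.asIdeal ∧ q ≤ p} + (s.encard : ℕ∞) := by
  let π := Ideal.Quotient.mk (Ideal.span s)
  have hle : Ideal.span s ≤ p.asIdeal := Ideal.span_le.2 hs
  let p' : PrimeSpectrum (R ⧸ Ideal.span s) :=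
    ⟨p.asIdeal.map π, Ideal.isPrime_map_quotientMk_of_isPrime hle⟩
  have hcomap : p'.comap π = p := PrimeSpectrum.ext <| by
    rw [PrimeSpectrum.comap_asIdeal, Ideal.comap_map_of_surjective _ Ideal.Quotient.mk_surjective]
    simpa [π, ← RingHom.ker_eq_comap_bot] using hle
  have hkrull : Order.krullDim (Set.Iic p') ≤
      Order.krullDim {q : PrimeSpectrum R // s ⊆ q.asIdeal ∧ q ≤ p} := by
    refine Order.krullDim_le_of_strictMono (fun q => ⟨q.1.comap π, fun x hx => ?_, ?_⟩)
      fun q₁ q₂ hq => lt_of_le_of_ne (Ideal.comap_mono hq.le) fun heq => hq.ne ?_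
    · have hx' : π x = 0 := Ideal.Quotient.eq_zero_iff_mem.2 (Ideal.subset_span hx)
      simp [hx']
    · exact hcomap ▸ Ideal.comap_mono q.2
    · exact Subtype.ext (PrimeSpectrum.comap_injective_of_surjective π
        Ideal.Quotient.mk_surjective (Subtype.ext_iff.1 heq))
  calc (p.asIdeal.height : WithBot ℕ∞)
      ≤ (p'.asIdeal.height : WithBot ℕ∞) + (s.encard : ℕ∞) :=
        mod_cast Ideal.height_le_height_add_encard_of_subset s hs
    _ ≤ _ := by
      rw [height_eq_krullDim_Iic]
      exact add_le_add_left hkrull _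

end CommutativeAlgebra

section Evaluation

variable {R σ τ : Type*} [CommSemiring R]

theorem eval_bind₁ (x : τ → R) (f : σ → MvPolynomial τ R) (g : MvPolynomial σ R) :
    eval x (bind₁ f g) = eval (fun s => eval x (f s)) g := by
  rw [hom_bind₁]
  congr 1
  ext <;> simp

theorem eval_mul_of_isWeightedHomogeneous {M : Type*} [AddCommMonoid M] {w : σ → M}
    (χ : Multiplicative M →* R) (v : σ → R) {g : MvPolynomial σ R} {k : M}
    (hg : IsWeightedHomogeneous w g k) :
    eval (fun s => χ (.ofAdd (w s)) * v s) g = χ (.ofAdd k) * eval v g := by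
  rw [eval_eq, eval_eq, Finset.mul_sum]
  refine Finset.sum_congr rfl fun d hd => ?_
  rw [← hg (mem_support_iff.1 hd), Finsupp.weight_apply, Finsupp.sum, ofAdd_sum, map_prod]
  simp only [mul_pow, Finset.prod_mul_distrib, ofAdd_nsmul, map_pow]
  ring

theorem eval_smul_of_isHomogeneous {g : MvPolynomial σ R} {n : ℕ} (hg : g.IsHomogeneous n)
    (c : R) (v : σ → R) : eval (c • v) g = c ^ n * eval v g := by
  simpa [powersHom_apply, Pi.smul_def] using
    eval_mul_of_isWeightedHomogeneous (w := (1 : σ → ℕ)) (powersHom R c) v hg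

end Evaluation

/-- The translation by `b`, as an automorphism of the polynomial ring. -/
noncomputable def translation {σ R : Type*} [CommRing R] (b : σ → R) :
    MvPolynomial σ R ≃ₐ[R] MvPolynomial σ R :=
  .ofAlgHom (aeval fun i => X i + C (b i)) (aeval fun i => X i - C (b i))
    (by ext; simp) (by ext; simp)

theorem eval_translation {σ R : Type*} [CommRing R] (a b : σ → R) (f : MvPolynomial σ R) :
    eval a (translation b f) = eval (a + b) f := by
  change eval a (bind₁ _ f) = _
  rw [eval_bind₁]
  simp [Pi.add_def]

/-- The Zariski topology of the affine space `K^σ`, seen inside the spectrum of its coordinate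
ring. As a local instance it takes precedence over the product topology of `σ → ℂ`. -/
@[reducible]
noncomputable def affineZariski {σ K : Type*} [Field K] : TopologicalSpace (σ → K) :=
  .induced (pointToPoint (k := K)) inferInstance

attribute [local instance] affineZariski

section AffineSpace

variable {σ K : Type*} [Field K]

theorem isInducing_pointToPoint :
    Topology.IsInducing (pointToPoint : (σ → K) → PrimeSpectrum (MvPolynomial σ K)) :=
  ⟨rfl⟩

theorem affineZariski_eq_generateFrom :
    (affineZariski : TopologicalSpace (σ → K)) =
      .generateFrom {U | ∃ g : MvPolynomial σ K, U = {x | eval x g ≠ 0}} := by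
  rw [affineZariski, PrimeSpectrum.isTopologicalBasis_basic_opens.eq_generateFrom,
    induced_generateFrom_eq]
  congr 1
  ext U
  simp only [Set.mem_image, Set.exists_range_iff]
  refine exists_congr fun g => eq_comm.trans (Eq.congr_right (Set.ext fun x => ?_))
  exact (mem_vanishingIdeal_singleton_iff _ _).not

theorem isClosed_zeroLocus (I : Ideal (MvPolynomial σ K)) :
    IsClosed (zeroLocus K I) := by
  convert (PrimeSpectrum.isClosed_zeroLocus (I : Set (MvPolynomial σ K))).preimage
    isInducing_pointToPoint.continuous
  ext x
  exact forall₂_congr fun f _ => (mem_vanishingIdeal_singleton_iff x f).symm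

theorem isIrreducible_of_isIrreducible_image {X Y : Type*} [TopologicalSpace X]
    [TopologicalSpace Y] {f : X → Y} (hf : Topology.IsInducing f) {S : Set X}
    (h : IsIrreducible (f '' S)) : IsIrreducible S := by
  refine ⟨h.1.of_image, fun U V hU hV ⟨x, hx, hxU⟩ ⟨y, hy, hyV⟩ => ?_⟩
  obtain ⟨U', hU', rfl⟩ := hf.isOpen_iff.1 hU
  obtain ⟨V', hV', rfl⟩ := hf.isOpen_iff.1 hV
  obtain ⟨_, ⟨z, hz, rfl⟩, hzUV⟩ :=
    h.2 U' V' hU' hV' ⟨f x, ⟨x, hx, rfl⟩, hxU⟩ ⟨f y, ⟨y, hy, rfl⟩, hyV⟩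
  exact ⟨z, hz, hzUV⟩

theorem isIrreducible_of_vanishingIdeal_isPrime {S : Set (σ → K)}
    (h : (vanishingIdeal K S).IsPrime) : IsIrreducible S := by
  refine isIrreducible_of_isIrreducible_image isInducing_pointToPoint ?_
  rwa [PrimeSpectrum.isIrreducible_iff_vanishingIdeal_isPrime, vanishingIdeal_pointToPoint]

section Dimension

variable [IsAlgClosed K] [Finite σ]

theorem vanishingIdeal_zeroLocus_inter_eval_ne_zero (q : Ideal (MvPolynomial σ K)) [q.IsPrime]
    {g : MvPolynomial σ K} (hg : g ∉ q) :
    vanishingIdeal K (zeroLocus K q ∩ {x | eval x g ≠ 0}) = q := by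
  refine le_antisymm (fun f hf => ?_) fun f hf x hx => hx.1 f hf
  have hgf : g * f ∈ vanishingIdeal K (zeroLocus K q) := fun x hx => by
    by_cases hgx : eval x g = 0
    · simp [aeval_eq_eval, hgx]
    · rw [map_mul, hf x ⟨hx, hgx⟩, mul_zero]
  rw [IsPrime.vanishingIdeal_zeroLocus] at hgf
  exact (Ideal.IsPrime.mem_or_mem ‹_› hgf).resolve_left hg

/-- The basic locally closed subset `f = 0 ≠ g` of affine space. -/
def basicLocus {ι : Type*} (f : ι → MvPolynomial σ K) (g : MvPolynomial σ K) : Set (σ → K) :=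
  {x | (∀ r, eval x (f r) = 0) ∧ eval x g ≠ 0}

theorem krullDim_primes_le_topologicalKrullDim_basicLocus {ι : Type*} (f : ι → MvPolynomial σ K)
    {g : MvPolynomial σ K} {p : PrimeSpectrum (MvPolynomial σ K)} (hg : g ∉ p.asIdeal) :
    Order.krullDim {q : PrimeSpectrum (MvPolynomial σ K) // Set.range f ⊆ q.asIdeal ∧ q ≤ p} ≤
      topologicalKrullDim (basicLocus f g) := by
  let Z (q : {q : PrimeSpectrum (MvPolynomial σ K) // Set.range f ⊆ q.asIdeal ∧ q ≤ p}) :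
      Set (basicLocus f g) := (↑) ⁻¹' zeroLocus K q.1.asIdeal
  have hZ : ∀ q, vanishingIdeal K (Subtype.val '' Z q) = q.1.asIdeal := by
    rintro ⟨q, hfq, hqp⟩
    have himage : Subtype.val '' Z ⟨q, hfq, hqp⟩ =
        zeroLocus K q.asIdeal ∩ {x | eval x g ≠ 0} := by
      rw [Subtype.image_preimage_coe]
      ext x
      exact ⟨fun hx => ⟨hx.2, hx.1.2⟩, fun hx => ⟨⟨fun r => hx.1 _ (hfq ⟨r, rfl⟩), hx.2⟩, hx.1⟩⟩
    rw [himage, vanishingIdeal_zeroLocus_inter_eval_ne_zero _ fun h => hg (hqp h)]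
  have hirr : ∀ q, IsIrreducible (Z q) := fun q =>
    isIrreducible_of_isIrreducible_image .subtypeVal <|
      isIrreducible_of_vanishingIdeal_isPrime <| (hZ q).symm ▸ q.1.isPrime
  rw [topologicalKrullDim, ← Order.krullDim_orderDual]
  refine Order.krullDim_le_of_strictMono (fun q => ⟨Z (OrderDual.ofDual q), hirr _,
    (isClosed_zeroLocus _).preimage continuous_subtype_val⟩) fun q q' hq => ?_
  refine lt_of_le_of_ne (fun x hx f hf => hx f (hq.le hf)) fun heq => hq.ne ?_
  have hZeq : Z (OrderDual.ofDual q) = Z (OrderDual.ofDual q') :=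
    congrArg TopologicalSpace.IrreducibleCloseds.carrier heq
  exact Subtype.ext (PrimeSpectrum.ext ((hZ (OrderDual.ofDual q)).symm.trans
    ((congrArg (fun S => vanishingIdeal K (Subtype.val '' S)) hZeq).trans (hZ _))))

theorem height_vanishingIdeal_singleton (a : σ → K) :
    (vanishingIdeal K {a} : Ideal (MvPolynomial σ K)).height = Nat.card σ := by
  have hdim : ringKrullDim (MvPolynomial σ K) = Nat.card σ := by simp
  have : FiniteRingKrullDim (MvPolynomial σ K) := by
    rw [finiteRingKrullDim_iff_ne_bot_and_top, hdim]
    exact ⟨WithBot.coe_ne_bot, (WithBot.coe_lt_coe.2 (ENat.natCast_lt_top (Nat.card σ))).ne⟩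
  obtain ⟨p, hp, hheight⟩ := Ideal.exists_isMaximal_height (R := MvPolynomial σ K)
  obtain ⟨b, rfl⟩ := isMaximal_iff_eq_vanishingIdeal_singleton.1 hp
  have hcomap : (vanishingIdeal K {a} : Ideal (MvPolynomial σ K)).comap
      (translation (b - a)).toRingEquiv = vanishingIdeal K {b} := by
    ext f
    rw [Ideal.mem_comap, mem_vanishingIdeal_singleton_iff, mem_vanishingIdeal_singleton_iff]
    simp [aeval_eq_eval, eval_translation]
  rw [← RingEquiv.height_comap (translation (b - a)).toRingEquiv, hcomap]
  exact_mod_cast hheight.trans hdim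

theorem card_le_topologicalKrullDim_add_card {ι : Type*} [Finite ι] {Y : Type*}
    [TopologicalSpace Y] {j : (σ → K) → Y} (hj : Topology.IsInducing j) {V : Set Y}
    (f : ι → MvPolynomial σ K) (g : MvPolynomial σ K) (hV : Set.MapsTo j (basicLocus f g) V)
    (hne : (basicLocus f g).Nonempty) :
    (Nat.card σ : WithBot ℕ∞) ≤ topologicalKrullDim V + (Nat.card ι : WithBot ℕ∞) := by
  obtain ⟨a, hfa, hga⟩ := hne
  have hmem (h : MvPolynomial σ K) : h ∈ (pointToPoint (k := K) a).asIdeal ↔ eval a h = 0 :=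
    mem_vanishingIdeal_singleton_iff a h
  have hcard : ((Set.range f).encard : WithBot ℕ∞) ≤ (Nat.card ι : WithBot ℕ∞) := by
    rw [← Set.image_univ]
    refine WithBot.coe_le_coe.2 ((Set.encard_image_le f Set.univ).trans ?_)
    rw [Set.encard_univ, ENat.card_eq_coe_natCard]
  calc (Nat.card σ : WithBot ℕ∞)
      = (pointToPoint (k := K) a).asIdeal.height :=
        congrArg _ (height_vanishingIdeal_singleton a).symm
    _ ≤ _ := height_le_krullDim_add_encard (Set.range f) _
        (Set.range_subset_iff.2 fun r => (hmem _).2 (hfa r))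
    _ ≤ topologicalKrullDim (basicLocus f g) + (Nat.card ι : WithBot ℕ∞) :=
      add_le_add (krullDim_primes_le_topologicalKrullDim_basicLocus f ((hmem g).not.2 hga)) hcard
    _ ≤ _ := add_le_add_left
        ((hj.comp .subtypeVal).codRestrict fun x => hV x.2).topologicalKrullDim_le _

end Dimension

end AffineSpace

section Homogenization

theorem exists_isWeightedHomogeneous_map_eq {R σ M A : Type*} [CommSemiring R] [CommSemiring A]
    [Algebra R A] [AddCommMonoid M] {w : σ → M} {ρ : MvPolynomial σ R →ₐ[R] A}
    (hρ : ∀ n, ∃ u, IsWeightedHomogeneous w u n ∧ ρ u = 1) (g : MvPolynomial σ R) :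
    ∃ h n, IsWeightedHomogeneous w h n ∧ ρ h = ρ g := by
  induction g using MvPolynomial.induction_on with
  | C a => exact ⟨C a, 0, isWeightedHomogeneous_C _ a, rfl⟩
  | add p q hp hq =>
    obtain ⟨P, n, hP, hPp⟩ := hp
    obtain ⟨Q, k, hQ, hQq⟩ := hq
    obtain ⟨u, hu, hu1⟩ := hρ n
    obtain ⟨v, hv, hv1⟩ := hρ k
    exact ⟨P * v + u * Q, n + k, (hP.mul hv).add (hu.mul hQ), by simp [hPp, hQq, hu1, hv1]⟩
  | mul_X p s hp =>
    obtain ⟨P, n, hP, hPp⟩ := hp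
    exact ⟨P * X s, n + w s, hP.mul (isWeightedHomogeneous_X _ _ _), by simp [hPp]⟩

end Homogenization

section Coordinates

theorem PSpace.exists_coords_mk {ι : Type} (v : ι → ℂ) (hv : v ≠ 0) :
    ∃ c : ℂ, c ≠ 0 ∧ (PSpace.mk v hv).coords = c • v := by
  obtain ⟨c, hc⟩ := Projectivization.exists_smul_eq_mk_rep ℂ v hv
  exact ⟨c, c.ne_zero, hc.symm⟩

theorem PSpace.coords_ne_zero {ι : Type} (P : PSpace ι) : P.coords ≠ 0 :=
  Projectivization.rep_nonzero P

/-- The first epipole, in homogeneous coordinates of a triple. -/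
def epipole₁ (v : TripleVar → ℂ) : Fin 3 → ℂ := fun l => v (.inl l)

/-- The second epipole, in homogeneous coordinates of a triple. -/
def epipole₂ (v : TripleVar → ℂ) : Fin 3 → ℂ := fun l => v (.inr (.inr l))

/-- The fundamental matrix, in homogeneous coordinates of a triple. -/
def fundamental (v : TripleVar → ℂ) : Matrix (Fin 3) (Fin 3) ℂ :=
  Matrix.of fun a b => v (.inr (.inl (a, b)))

/-- The action on homogeneous coordinates of triples of one scalar for each of the factors. -/
def rescale (c₁ c₂ c₃ : ℂ) (v : TripleVar → ℂ) : TripleVar → ℂ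
  | .inl l => c₁ * v (.inl l)
  | .inr (.inl l) => c₂ * v (.inr (.inl l))
  | .inr (.inr l) => c₃ * v (.inr (.inr l))

theorem eval_rescale (c₁ c₂ c₃ : ℂ) (v : TripleVar → ℂ) {g : MvPolynomial TripleVar ℂ}
    {n : ℕ × ℕ × ℕ} (hg : IsWeightedHomogeneous TripleVar.weight g n) :
    eval (rescale c₁ c₂ c₃ v) g = c₁ ^ n.1 * (c₂ ^ n.2.1 * c₃ ^ n.2.2) * eval v g := by
  let χ : Multiplicative (ℕ × ℕ × ℕ) →* ℂ :=
    { toFun k := c₁ ^ k.toAdd.1 * (c₂ ^ k.toAdd.2.1 * c₃ ^ k.toAdd.2.2)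
      map_one' := by simp
      map_mul' a b := by simp [pow_add]; ring }
  have hχ : rescale c₁ c₂ c₃ v = fun s => χ (.ofAdd s.weight) * v s := by
    ext s
    rcases s with s | s | s <;> simp [χ, rescale, TripleVar.weight]
  rw [hχ, eval_mul_of_isWeightedHomogeneous χ v hg]
  rfl

end Coordinates

section Chart

/-- The coordinates of the affine chart of `ℙ² × ℙ⁸ × ℙ²` in which the coordinates numbered
`i`, `k` and `j` of the three factors are `1`. -/
abbrev ChartVar (i : Fin 3) (k : Fin 3 × Fin 3) (j : Fin 3) : Type :=
  {s : TripleVar // s ≠ .inl i ∧ s ≠ .inr (.inl k) ∧ s ≠ .inr (.inr j)}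

theorem card_chartVar (i : Fin 3) (k : Fin 3 × Fin 3) (j : Fin 3) :
    Nat.card (ChartVar i k j) = 12 := by
  rw [Nat.card_eq_fintype_card]
  revert i k j
  decide

variable {i : Fin 3} {k : Fin 3 × Fin 3} {j : Fin 3}

/-- The multihomogeneous coordinates as functions of the coordinates of the chart. -/
noncomputable def chartPoly (s : TripleVar) : MvPolynomial (ChartVar i k j) ℂ :=
  if h : s ≠ .inl i ∧ s ≠ .inr (.inl k) ∧ s ≠ .inr (.inr j) then X ⟨s, h⟩ else 1

/-- The multihomogeneous coordinates of the point of the chart with coordinates `x`. -/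
noncomputable def chartCoords (x : ChartVar i k j → ℂ) (s : TripleVar) : ℂ :=
  eval x (chartPoly s)

theorem chartPoly_inl : chartPoly (.inl i) = (1 : MvPolynomial (ChartVar i k j) ℂ) := by
  simp [chartPoly]

theorem chartPoly_inr_inl :
    chartPoly (.inr (.inl k)) = (1 : MvPolynomial (ChartVar i k j) ℂ) := by
  simp [chartPoly]

theorem chartPoly_inr_inr :
    chartPoly (.inr (.inr j)) = (1 : MvPolynomial (ChartVar i k j) ℂ) := by
  simp [chartPoly]

theorem chartPoly_coe (s : ChartVar i k j) : chartPoly s.1 = X s := by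
  rw [chartPoly, dif_pos s.2]

theorem epipole₁_chartCoords (x : ChartVar i k j → ℂ) : epipole₁ (chartCoords x) i = 1 := by
  simp [epipole₁, chartCoords, chartPoly_inl]

theorem fundamental_chartCoords (x : ChartVar i k j → ℂ) :
    fundamental (chartCoords x) k.1 k.2 = 1 := by
  simp [fundamental, chartCoords, chartPoly_inr_inl]

theorem epipole₂_chartCoords (x : ChartVar i k j → ℂ) : epipole₂ (chartCoords x) j = 1 := by
  simp [epipole₂, chartCoords, chartPoly_inr_inr]

theorem exists_chartCoords_eq {v : TripleVar → ℂ} (hi : epipole₁ v i = 1)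
    (hk : fundamental v k.1 k.2 = 1) (hj : epipole₂ v j = 1) :
    ∃ x : ChartVar i k j → ℂ, chartCoords x = v := by
  refine ⟨fun s => v s.1, _root_.funext fun s => ?_⟩
  by_cases h : s ≠ .inl i ∧ s ≠ .inr (.inl k) ∧ s ≠ .inr (.inr j)
  · exact (congrArg (eval _) (chartPoly_coe ⟨s, h⟩)).trans (eval_X _)
  · simp only [chartCoords, chartPoly, dif_neg h, map_one]
    simp only [not_and_or, not_not] at h
    rcases h with rfl | rfl | rfl
    exacts [hi.symm, hk.symm, hj.symm]

/-- The point of the chart with coordinates `x`. -/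
noncomputable def chart (x : ChartVar i k j → ℂ) : Triple where
  e₁ := .mk (epipole₁ (chartCoords x)) fun h => by
    simpa [epipole₁_chartCoords] using congrFun h i
  F := .mk (fun l => chartCoords x (.inr (.inl l))) fun h =>
    one_ne_zero ((fundamental_chartCoords x).symm.trans (congrFun h k))
  e₂ := .mk (epipole₂ (chartCoords x)) fun h => by
    simpa [epipole₂_chartCoords] using congrFun h j

theorem exists_coords_chart_eq_rescale (x : ChartVar i k j → ℂ) :
    ∃ c₁ c₂ c₃ : ℂ, c₁ ≠ 0 ∧ c₂ ≠ 0 ∧ c₃ ≠ 0 ∧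
      (chart x).coords = rescale c₁ c₂ c₃ (chartCoords x) := by
  obtain ⟨c₁, hc₁, h₁⟩ := PSpace.exists_coords_mk (epipole₁ (chartCoords x)) _
  obtain ⟨c₂, hc₂, h₂⟩ := PSpace.exists_coords_mk (fun l => chartCoords x (.inr (.inl l))) _
  obtain ⟨c₃, hc₃, h₃⟩ := PSpace.exists_coords_mk (epipole₂ (chartCoords x)) _
  refine ⟨c₁, c₂, c₃, hc₁, hc₂, hc₃, _root_.funext fun s => ?_⟩
  rcases s with l | l | l
  exacts [congrFun h₁ l, congrFun h₂ l, congrFun h₃ l]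

theorem eval_bind₁_chartPoly (x : ChartVar i k j → ℂ) (g : MvPolynomial TripleVar ℂ) :
    eval x (bind₁ chartPoly g) = eval (chartCoords x) g :=
  eval_bind₁ x chartPoly g

theorem eval_coords_chart_eq_zero_iff (x : ChartVar i k j → ℂ) {g : MvPolynomial TripleVar ℂ}
    {n : ℕ × ℕ × ℕ} (hg : IsWeightedHomogeneous TripleVar.weight g n) :
    eval (chart x).coords g = 0 ↔ eval x (bind₁ chartPoly g) = 0 := by
  obtain ⟨c₁, c₂, c₃, hc₁, hc₂, hc₃, hcoords⟩ := exists_coords_chart_eq_rescale x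
  rw [hcoords, eval_rescale _ _ _ _ hg, eval_bind₁_chartPoly]
  simp [hc₁, hc₂, hc₃]

theorem exists_homogenization (f : MvPolynomial (ChartVar i k j) ℂ) :
    ∃ g n, IsWeightedHomogeneous TripleVar.weight g n ∧ bind₁ chartPoly g = f := by
  have hone (n : ℕ × ℕ × ℕ) : ∃ u, IsWeightedHomogeneous TripleVar.weight u n ∧
      bind₁ (chartPoly (i := i) (k := k) (j := j)) u = 1 := by
    refine ⟨X (.inl i) ^ n.1 * X (.inr (.inl k)) ^ n.2.1 * X (.inr (.inr j)) ^ n.2.2, ?_, ?_⟩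
    · simpa [TripleVar.weight] using
        (((isWeightedHomogeneous_X ℂ TripleVar.weight (.inl i)).pow n.1).mul
          ((isWeightedHomogeneous_X ℂ TripleVar.weight (.inr (.inl k))).pow n.2.1)).mul
          ((isWeightedHomogeneous_X ℂ TripleVar.weight (.inr (.inr j))).pow n.2.2)
    · simp [chartPoly_inl, chartPoly_inr_inl, chartPoly_inr_inr]
  obtain ⟨g, n, hg, hgf⟩ := exists_isWeightedHomogeneous_map_eq hone (rename Subtype.val f)
  refine ⟨g, n, hg, hgf.trans ?_⟩
  rw [bind₁_rename, show chartPoly ∘ Subtype.val = (X : ChartVar i k j → _) from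
    _root_.funext chartPoly_coe, bind₁_X_left, AlgHom.id_apply]

theorem isInducing_chart :
    Topology.IsInducing (chart : (ChartVar i k j → ℂ) → Triple) := by
  refine ⟨?_⟩
  rw [affineZariski_eq_generateFrom, Triple.zariski, induced_generateFrom_eq]
  congr 1
  have hpreimage {g : MvPolynomial TripleVar ℂ} {n : ℕ × ℕ × ℕ}
      (hg : IsWeightedHomogeneous TripleVar.weight g n) :
      chart ⁻¹' {t | eval t.coords g ≠ 0} =
        {x : ChartVar i k j → ℂ | eval x (bind₁ chartPoly g) ≠ 0} :=
    Set.ext fun x => (eval_coords_chart_eq_zero_iff x hg).not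
  refine Set.Subset.antisymm ?_ ?_
  · rintro _ ⟨f, rfl⟩
    obtain ⟨g, n, hg, rfl⟩ := exists_homogenization f
    exact ⟨_, ⟨g, n, hg, rfl⟩, hpreimage hg⟩
  · rintro _ ⟨_, ⟨g, n, hg, rfl⟩, rfl⟩
    exact ⟨_, hpreimage hg⟩

end Chart

section Interpolation

variable {σ K : Type*} [Field K] [CharZero K] {f : MvPolynomial σ K} {m : ℕ} {e u w : σ → K}

theorem eval_add_smul_eq_zero (hf : f.totalDegree ≤ m)
    (h : ∀ n : Fin (m + 1), eval (u + (n : K) • w) f = 0) (t : K) : eval (u + t • w) f = 0 := by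
  let q : Polynomial K := aeval (fun s => .C (w s) * .X + .C (u s)) f
  have hq (t : K) : q.eval t = eval (u + t • w) f := by
    rw [← Polynomial.coe_aeval_eq_eval, ← AlgHom.comp_apply, comp_aeval, aeval_eq_eval]
    congr 2
    ext s
    simp only [Polynomial.coe_aeval_eq_eval, Polynomial.eval_add, Polynomial.eval_mul,
      Polynomial.eval_C, Polynomial.eval_X, Pi.add_apply, Pi.smul_apply, smul_eq_mul]
    ring
  have hdegree : q.natDegree < m + 1 := Nat.lt_succ_of_le <|
    (aeval_natDegree_le f hf _ fun s => Polynomial.natDegree_linear_le).trans_eq (mul_one m)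
  have hzero : q = 0 := Polynomial.eq_zero_of_natDegree_lt_card_of_eval_eq_zero q
    (f := fun n : Fin (m + 1) => (n : K)) (fun a b hab => Fin.ext (Nat.cast_injective hab))
    (fun n => (hq n).trans (h n)) (by simpa using hdegree)
  rw [← hq, hzero, Polynomial.eval_zero]

theorem eval_smul_add_smul_eq_zero (hf : f.IsHomogeneous m)
    (h : ∀ n : Fin (m + 1), eval (u + (n : K) • w) f = 0) (a b : K) :
    eval (a • u + b • w) f = 0 := by
  have hne {a : K} (ha : a ≠ 0) (b : K) : eval (a • u + b • w) f = 0 := by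
    rw [show a • u + b • w = a • (u + (b / a) • w) by
        rw [smul_add, smul_smul, mul_div_cancel₀ b ha],
      eval_smul_of_isHomogeneous hf, eval_add_smul_eq_zero hf.totalDegree_le h, mul_zero]
  obtain rfl | ha := eq_or_ne a 0
  · have hshift (n : Fin (m + 1)) : eval (u + b • w + (n : K) • u) f = 0 := by
      have := hne (Nat.cast_add_one_ne_zero (n : ℕ)) b
      rwa [show u + b • w + (n : K) • u = ((n : K) + 1) • u + b • w by module]
    simpa using eval_add_smul_eq_zero hf.totalDegree_le hshift (-1)
  · exact hne ha b

theorem eq_zero_of_forall_eval_add_smul_eq_zero (hf : f.IsHomogeneous m)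
    (hspan : Submodule.span K {e, u, w} = ⊤)
    (hinv : ∀ (p : σ → K) (c : K), eval (p + c • e) f = eval p f)
    (h : ∀ n : Fin (m + 1), eval (u + (n : K) • w) f = 0) : f = 0 := by
  refine MvPolynomial.funext fun p => ?_
  obtain ⟨c, a, b, rfl⟩ :=
    Submodule.mem_span_triple.1 (hspan ▸ Submodule.mem_top : p ∈ Submodule.span K {e, u, w})
  rw [add_assoc, add_comm, hinv, eval_smul_add_smul_eq_zero hf h, map_zero]

theorem eq_C_div_mul_of_eval_mul_eval_eq {g : MvPolynomial σ K} (hf : f.IsHomogeneous m)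
    (hg : g.IsHomogeneous m) (hspan : Submodule.span K {e, u, w} = ⊤)
    (hinvf : ∀ (p : σ → K) (c : K), eval (p + c • e) f = eval p f)
    (hinvg : ∀ (p : σ → K) (c : K), eval (p + c • e) g = eval p g) {p₀ : σ → K}
    (hp₀ : eval p₀ g ≠ 0)
    (h : ∀ n : Fin (m + 1), eval (u + (n : K) • w) f * eval p₀ g =
      eval p₀ f * eval (u + (n : K) • w) g) :
    f = C (eval p₀ f / eval p₀ g) * g := by
  rw [← sub_eq_zero]
  refine eq_zero_of_forall_eval_add_smul_eq_zero (hf.sub (hg.C_mul _)) hspan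
    (fun p c => by simp [hinvf, hinvg]) fun n => ?_
  rw [map_sub, map_mul, eval_C, sub_eq_zero, div_mul_eq_mul_div, eq_div_iff hp₀, h]

end Interpolation

section LinearAlgebra

variable {K : Type*} [Field K]

theorem span_insert_single_add_one_add_two {e : Fin 3 → K} {i : Fin 3} (he : e i ≠ 0) :
    Submodule.span K {e, Pi.single (i + 1) 1, Pi.single (i + 2) 1} = ⊤ := by
  refine eq_top_iff.2 fun p _ => Submodule.mem_span_triple.2 ⟨p i / e i,
    p (i + 1) - p i / e i * e (i + 1), p (i + 2) - p i / e i * e (i + 2), ?_⟩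
  have hi := div_mul_cancel₀ (p i) he
  ext a
  fin_cases i <;> fin_cases a <;> simp_all

theorem vecMul_eq_zero_of_forall_ne {m n : Type*} [Fintype m] [Fintype n] {M : Matrix m n K}
    {e : n → K} {e' : m → K} {i : n} (he : e i ≠ 0) (hMe : M *ᵥ e = 0)
    (h : ∀ l, l ≠ i → (e' ᵥ* M) l = 0) : e' ᵥ* M = 0 := by
  have hi : (e' ᵥ* M) i * e i = 0 := by
    rw [← Fintype.sum_eq_single (f := fun l => (e' ᵥ* M) l * e l) i fun l hl => by
      rw [h l hl, zero_mul]]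
    exact (Matrix.dotProduct_mulVec e' M e).symm.trans (by rw [hMe, dotProduct_zero])
  ext l
  obtain rfl | hl := eq_or_ne l i
  exacts [(mul_eq_zero.1 hi).resolve_right he, h l hl]

end LinearAlgebra

section KruppaForms

variable {φ : MvPolynomial (Fin 3) ℂ} {m : ℕ}

theorem eval_compXi (φ : MvPolynomial (Fin 3) ℂ) (F : Matrix (Fin 3) (Fin 3) ℂ) (p : Fin 3 → ℂ) :
    eval p (compXi φ F) = eval (F *ᵥ p) φ := by
  rw [compXi, eval_bind₁]
  congr 2
  ext i
  simp [Matrix.mulVec, dotProduct]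

theorem eval_compGamma (φ : MvPolynomial (Fin 3) ℂ) (e p : Fin 3 → ℂ) :
    eval p (compGamma φ e) = eval (e ⨯₃ p) φ := by
  rw [compGamma, eval_bind₁]
  congr 2
  ext i
  fin_cases i <;> simp [cross_apply]

theorem isHomogeneous_compXi (h : φ.IsHomogeneous m) (F : Matrix (Fin 3) (Fin 3) ℂ) :
    (compXi φ F).IsHomogeneous m := by
  rw [← one_mul m]
  exact h.aeval _ fun i => .sum _ _ _ fun j _ => isHomogeneous_C_mul_X _ _

theorem isHomogeneous_compGamma (h : φ.IsHomogeneous m) (e : Fin 3 → ℂ) :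
    (compGamma φ e).IsHomogeneous m := by
  rw [← one_mul m]
  refine h.aeval _ fun i => ?_
  rw [cross_apply]
  fin_cases i <;> exact (isHomogeneous_C_mul_X _ _).sub (isHomogeneous_C_mul_X _ _)

theorem compXi_smul (h : φ.IsHomogeneous m) (c : ℂ) (F : Matrix (Fin 3) (Fin 3) ℂ) :
    compXi φ (c • F) = C (c ^ m) * compXi φ F := by
  refine MvPolynomial.funext fun p => ?_
  rw [eval_compXi, Matrix.smul_mulVec, eval_smul_of_isHomogeneous h, map_mul, eval_C, eval_compXi]

theorem compGamma_smul (h : φ.IsHomogeneous m) (c : ℂ) (e : Fin 3 → ℂ) :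
    compGamma φ (c • e) = C (c ^ m) * compGamma φ e := by
  refine MvPolynomial.funext fun p => ?_
  rw [eval_compGamma, map_smul, LinearMap.smul_apply, eval_smul_of_isHomogeneous h, map_mul,
    eval_C, eval_compGamma]

theorem eval_compXi_add_smul (φ : MvPolynomial (Fin 3) ℂ) {F : Matrix (Fin 3) (Fin 3) ℂ}
    {e : Fin 3 → ℂ} (he : F *ᵥ e = 0) (p : Fin 3 → ℂ) (c : ℂ) :
    eval (p + c • e) (compXi φ F) = eval p (compXi φ F) := by
  rw [eval_compXi, eval_compXi, Matrix.mulVec_add, Matrix.mulVec_smul, he, smul_zero, add_zero]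

theorem eval_compGamma_add_smul (φ : MvPolynomial (Fin 3) ℂ) (e p : Fin 3 → ℂ) (c : ℂ) :
    eval (p + c • e) (compGamma φ e) = eval p (compGamma φ e) := by
  rw [eval_compGamma, eval_compGamma, map_add, map_smul, cross_self, smul_zero, add_zero]

end KruppaForms

section KruppaSolutions

variable {φ₁ φ₂ : MvPolynomial (Fin 3) ℂ} {m : ℕ} {c : ℂ} {v : TripleVar → ℂ}

/-- The vector `v` consists of homogeneous coordinates of a triple `(e₁, F, e₂)` with `F e₁ = 0`
and `e₂ᵀ F = 0` that satisfies the Kruppa equation with the scalar `c`. -/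
structure IsKruppaSolution (φ₁ φ₂ : MvPolynomial (Fin 3) ℂ) (c : ℂ) (v : TripleVar → ℂ) :
    Prop where
  epipole₁_ne_zero : epipole₁ v ≠ 0
  fundamental_ne_zero : fundamental v ≠ 0
  epipole₂_ne_zero : epipole₂ v ≠ 0
  mulVec_eq_zero : fundamental v *ᵥ epipole₁ v = 0
  vecMul_eq_zero : epipole₂ v ᵥ* fundamental v = 0
  compXi_eq : compXi φ₂ (fundamental v) = C c * compGamma φ₁ (epipole₁ v)

theorem isKruppaSolution_coords_iff {t : Triple} :
    IsKruppaSolution φ₁ φ₂ c t.coords ↔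
      compXi φ₂ t.F.matrix = C c * compGamma φ₁ t.e₁.coords ∧ IsEpipolar t := by
  refine ⟨fun h => ⟨h.compXi_eq, h.mulVec_eq_zero, h.vecMul_eq_zero⟩, fun h =>
    ⟨t.e₁.coords_ne_zero, fun hF => t.F.coords_ne_zero ?_, t.e₂.coords_ne_zero,
      h.2.1, h.2.2, h.1⟩⟩
  exact _root_.funext fun l => congrFun₂ hF l.1 l.2

theorem IsKruppaSolution.rescale (h : IsKruppaSolution φ₁ φ₂ c v) (hφ₁ : φ₁.IsHomogeneous m)
    (hφ₂ : φ₂.IsHomogeneous m) {c₁ c₂ c₃ : ℂ} (hc₁ : c₁ ≠ 0) (hc₂ : c₂ ≠ 0) (hc₃ : c₃ ≠ 0) :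
    IsKruppaSolution φ₁ φ₂ ((c₂ / c₁) ^ m * c) (rescale c₁ c₂ c₃ v) where
  epipole₁_ne_zero := smul_ne_zero hc₁ h.epipole₁_ne_zero
  fundamental_ne_zero := smul_ne_zero hc₂ h.fundamental_ne_zero
  epipole₂_ne_zero := smul_ne_zero hc₃ h.epipole₂_ne_zero
  mulVec_eq_zero := by
    change (c₂ • fundamental v) *ᵥ (c₁ • epipole₁ v) = 0
    rw [Matrix.smul_mulVec, Matrix.mulVec_smul, h.mulVec_eq_zero, smul_zero, smul_zero]
  vecMul_eq_zero := by
    change (c₃ • epipole₂ v) ᵥ* (c₂ • fundamental v) = 0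
    rw [Matrix.smul_vecMul, Matrix.vecMul_smul, h.vecMul_eq_zero, smul_zero, smul_zero]
  compXi_eq := by
    change compXi φ₂ (c₂ • fundamental v) = _ * compGamma φ₁ (c₁ • epipole₁ v)
    rw [compXi_smul hφ₂, compGamma_smul hφ₁, h.compXi_eq, ← mul_assoc, ← mul_assoc, ← C_mul,
      ← C_mul]
    congr 2
    rw [div_pow]
    field_simp

/-- The value `φ(F p)` as a polynomial in the coordinates of a triple. -/
noncomputable def xiAt (φ : MvPolynomial (Fin 3) ℂ) (p : Fin 3 → ℂ) : MvPolynomial TripleVar ℂ :=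
  bind₁ (fun a => ∑ b, X (.inr (.inl (a, b))) * C (p b)) φ

/-- The value `φ(e₁ × p)` as a polynomial in the coordinates of a triple. -/
noncomputable def gammaAt (φ : MvPolynomial (Fin 3) ℂ) (p : Fin 3 → ℂ) :
    MvPolynomial TripleVar ℂ :=
  bind₁ ((fun a => X (.inl a)) ⨯₃ (fun a => C (p a))) φ

theorem eval_xiAt (φ : MvPolynomial (Fin 3) ℂ) (p : Fin 3 → ℂ) (v : TripleVar → ℂ) :
    eval v (xiAt φ p) = eval p (compXi φ (fundamental v)) := by
  rw [xiAt, eval_bind₁, eval_compXi]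
  congr 2
  ext a
  simp [Matrix.mulVec, dotProduct, fundamental]

theorem eval_gammaAt (φ : MvPolynomial (Fin 3) ℂ) (p : Fin 3 → ℂ) (v : TripleVar → ℂ) :
    eval v (gammaAt φ p) = eval p (compGamma φ (epipole₁ v)) := by
  rw [gammaAt, eval_bind₁, eval_compGamma]
  congr 2
  ext a
  fin_cases a <;> simp [cross_apply, epipole₁]

/-- The points of the line `p i = 0` at which the two sides of the Kruppa equation are compared. -/
noncomputable def linePoint (i : Fin 3) (n : ℕ) : Fin 3 → ℂ :=
  Pi.single (i + 1) 1 + (n : ℂ) • Pi.single (i + 2) 1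

/-- The local equations of the Kruppa variety where `e₁ i ≠ 0`: `F e₁ = 0`, the coordinates other
than `i` of `e₂ᵀ F = 0`, and the proportionality of the values of the two forms at `m + 1` points,
of which the one numbered `n₀` serves as a reference. -/
noncomputable def localEquation (φ₁ φ₂ : MvPolynomial (Fin 3) ℂ) (i : Fin 3) {m : ℕ}
    (n₀ : Fin (m + 1)) :
    Fin 3 ⊕ {l : Fin 3 // l ≠ i} ⊕ {n : Fin (m + 1) // n ≠ n₀} → MvPolynomial TripleVar ℂ
  | .inl a => ∑ b, X (.inr (.inl (a, b))) * X (.inl b)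
  | .inr (.inl l) => ∑ a, X (.inr (.inr a)) * X (.inr (.inl (a, l.1)))
  | .inr (.inr n) => xiAt φ₂ (linePoint i n.1) * gammaAt φ₁ (linePoint i n₀) -
      xiAt φ₂ (linePoint i n₀) * gammaAt φ₁ (linePoint i n.1)

theorem card_localEquation (i : Fin 3) (n₀ : Fin (m + 1)) :
    Nat.card (Fin 3 ⊕ {l : Fin 3 // l ≠ i} ⊕ {n : Fin (m + 1) // n ≠ n₀}) = 5 + m := by
  simp [Fintype.card_subtype_compl]
  omega

theorem forall_eval_localEquation_eq_zero_iff {i : Fin 3} {n₀ : Fin (m + 1)} :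
    (∀ r, eval v (localEquation φ₁ φ₂ i n₀ r) = 0) ↔
      fundamental v *ᵥ epipole₁ v = 0 ∧ (∀ l, l ≠ i → (epipole₂ v ᵥ* fundamental v) l = 0) ∧
      ∀ n : Fin (m + 1), n ≠ n₀ →
        eval (linePoint i n) (compXi φ₂ (fundamental v)) *
            eval (linePoint i n₀) (compGamma φ₁ (epipole₁ v)) =
          eval (linePoint i n₀) (compXi φ₂ (fundamental v)) *
            eval (linePoint i n) (compGamma φ₁ (epipole₁ v)) := by
  simp [localEquation, Sum.forall, funext_iff, Matrix.mulVec, Matrix.vecMul, dotProduct,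
    fundamental, epipole₁, epipole₂, eval_xiAt, eval_gammaAt, sub_eq_zero]

theorem exists_eval_linePoint_compGamma_ne_zero {φ : MvPolynomial (Fin 3) ℂ}
    (hφ : φ.IsHomogeneous m) {e : Fin 3 → ℂ} {i : Fin 3} (he : e i ≠ 0) (h : compGamma φ e ≠ 0) :
    ∃ n : Fin (m + 1), eval (linePoint i n) (compGamma φ e) ≠ 0 := by
  by_contra! hzero
  exact h (eq_zero_of_forall_eval_add_smul_eq_zero (isHomogeneous_compGamma hφ e)
    (span_insert_single_add_one_add_two he) (eval_compGamma_add_smul φ e) hzero)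

theorem isKruppaSolution_of_localEquation (hφ₁ : φ₁.IsHomogeneous m) (hφ₂ : φ₂.IsHomogeneous m)
    {i : Fin 3} {n₀ : Fin (m + 1)} (hi : epipole₁ v i ≠ 0) (hF : fundamental v ≠ 0)
    (hv : epipole₂ v ≠ 0) (heq : ∀ r, eval v (localEquation φ₁ φ₂ i n₀ r) = 0)
    (hγ : eval v (gammaAt φ₁ (linePoint i n₀)) ≠ 0) :
    IsKruppaSolution φ₁ φ₂
      (eval v (xiAt φ₂ (linePoint i n₀)) / eval v (gammaAt φ₁ (linePoint i n₀))) v := by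
  obtain ⟨hFe, heF, hprop⟩ := forall_eval_localEquation_eq_zero_iff.1 heq
  refine ⟨fun h => hi (congrFun h i), hF, hv, hFe, vecMul_eq_zero_of_forall_ne hi hFe heF, ?_⟩
  rw [eval_gammaAt] at hγ
  rw [eval_xiAt, eval_gammaAt]
  refine eq_C_div_mul_of_eval_mul_eval_eq (isHomogeneous_compXi hφ₂ _)
    (isHomogeneous_compGamma hφ₁ _) (span_insert_single_add_one_add_two hi)
    (eval_compXi_add_smul φ₂ hFe) (eval_compGamma_add_smul φ₁ _) hγ fun n => ?_
  obtain rfl | hn := eq_or_ne n n₀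
  exacts [rfl, hprop n hn]

theorem IsKruppaSolution.eval_compXi (h : IsKruppaSolution φ₁ φ₂ c v) (p : Fin 3 → ℂ) :
    eval p (compXi φ₂ (fundamental v)) = c * eval p (compGamma φ₁ (epipole₁ v)) := by
  rw [h.compXi_eq, map_mul, eval_C]

theorem IsKruppaSolution.eval_localEquation (h : IsKruppaSolution φ₁ φ₂ c v) (i : Fin 3)
    (n₀ : Fin (m + 1)) : ∀ r, eval v (localEquation φ₁ φ₂ i n₀ r) = 0 :=
  forall_eval_localEquation_eq_zero_iff.2 ⟨h.mulVec_eq_zero,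
    fun l _ => congrFun h.vecMul_eq_zero l, fun n _ => by
      rw [h.eval_compXi, h.eval_compXi]
      ring⟩

theorem IsKruppaSolution.exists_coords_chart {i : Fin 3} {k : Fin 3 × Fin 3} {j : Fin 3}
    {x : ChartVar i k j → ℂ} (h : IsKruppaSolution φ₁ φ₂ c (chartCoords x))
    (hφ₁ : φ₁.IsHomogeneous m) (hφ₂ : φ₂.IsHomogeneous m) :
    ∃ c', (c' = 0 ↔ c = 0) ∧ IsKruppaSolution φ₁ φ₂ c' (chart x).coords := by
  obtain ⟨c₁, c₂, c₃, hc₁, hc₂, hc₃, hcoords⟩ := exists_coords_chart_eq_rescale x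
  exact ⟨_, mul_eq_zero_iff_left (pow_ne_zero _ (div_ne_zero hc₂ hc₁)),
    hcoords ▸ h.rescale hφ₁ hφ₂ hc₁ hc₂ hc₃⟩

theorem IsKruppaSolution.exists_chartCoords (h : IsKruppaSolution φ₁ φ₂ c v)
    (hφ₁ : φ₁.IsHomogeneous m) (hφ₂ : φ₂.IsHomogeneous m)
    (hγ : compGamma φ₁ (epipole₁ v) ≠ 0) :
    ∃ i k j, ∃ (x : ChartVar i k j → ℂ) (c' : ℂ), (c' = 0 ↔ c = 0) ∧
      IsKruppaSolution φ₁ φ₂ c' (chartCoords x) ∧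
      compGamma φ₁ (epipole₁ (chartCoords x)) ≠ 0 := by
  obtain ⟨i, hi⟩ := Function.ne_iff.1 h.epipole₁_ne_zero
  obtain ⟨a, ha⟩ := Function.ne_iff.1 h.fundamental_ne_zero
  obtain ⟨b, hb⟩ := Function.ne_iff.1 ha
  obtain ⟨j, hj⟩ := Function.ne_iff.1 h.epipole₂_ne_zero
  have hi' := inv_ne_zero hi
  obtain ⟨x, hx⟩ := exists_chartCoords_eq (i := i) (k := (a, b)) (j := j)
    (v := Kruppa.rescale (epipole₁ v i)⁻¹ (fundamental v a b)⁻¹ (epipole₂ v j)⁻¹ v)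
    (inv_mul_cancel₀ hi) (inv_mul_cancel₀ hb) (inv_mul_cancel₀ hj)
  refine ⟨i, (a, b), j, x, _,
    mul_eq_zero_iff_left (pow_ne_zero _ (div_ne_zero (inv_ne_zero hb) hi')),
    hx ▸ h.rescale hφ₁ hφ₂ hi' (inv_ne_zero hb) (inv_ne_zero hj), ?_⟩
  rw [hx]
  change compGamma φ₁ ((epipole₁ v i)⁻¹ • epipole₁ v) ≠ 0
  rw [compGamma_smul hφ₁]
  exact mul_ne_zero (C_ne_zero.2 (pow_ne_zero _ hi')) hγ

theorem IsKruppaSolution.seven_le_topologicalKrullDim_add_of_chartCoords {i : Fin 3}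
    {k : Fin 3 × Fin 3} {j : Fin 3} {x : ChartVar i k j → ℂ}
    (h : IsKruppaSolution φ₁ φ₂ c (chartCoords x)) (hφ₁ : φ₁.IsHomogeneous m)
    (hφ₂ : φ₂.IsHomogeneous m) (hγ : compGamma φ₁ (epipole₁ (chartCoords x)) ≠ 0) {V : Set Triple}
    (hV : ∀ t c', (c' = 0 → c = 0) → IsKruppaSolution φ₁ φ₂ c' t.coords → t ∈ V) :
    (7 : WithBot ℕ∞) ≤ topologicalKrullDim V + (m : WithBot ℕ∞) := by
  have hi (y : ChartVar i k j → ℂ) : epipole₁ (chartCoords y) i ≠ 0 :=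
    (epipole₁_chartCoords y).trans_ne one_ne_zero
  obtain ⟨n₀, hn₀⟩ := exists_eval_linePoint_compGamma_ne_zero hφ₁ (hi x) hγ
  -- The factor `xiAt` keeps the scalar away from `0` if it is non-zero at the given solution.
  let g := gammaAt φ₁ (linePoint i n₀) * if c = 0 then 1 else xiAt φ₂ (linePoint i n₀)
  let f r : MvPolynomial (ChartVar i k j) ℂ := bind₁ chartPoly (localEquation φ₁ φ₂ i n₀ r)
  have hmaps : Set.MapsTo chart (basicLocus f (bind₁ chartPoly g)) V := by
    rintro y ⟨hfy, hgy⟩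
    simp only [f, eval_bind₁_chartPoly] at hfy hgy
    obtain ⟨hγy, hξy⟩ := mul_ne_zero_iff.1 ((map_mul _ _ _).symm.trans_ne hgy)
    obtain ⟨c', hc', hy⟩ := (isKruppaSolution_of_localEquation hφ₁ hφ₂ (hi y)
      (fun hF => one_ne_zero ((fundamental_chartCoords y).symm.trans (congrFun₂ hF k.1 k.2)))
      (fun he => one_ne_zero ((epipole₂_chartCoords y).symm.trans (congrFun he j)))
      hfy hγy).exists_coords_chart hφ₁ hφ₂
    refine hV _ c' (fun hzero => ?_) hy
    by_contra hc
    rw [if_neg hc] at hξy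
    exact div_ne_zero hξy hγy (hc'.1 hzero)
  have hne : (basicLocus f (bind₁ chartPoly g)).Nonempty := by
    refine ⟨x, fun r => ?_, ?_⟩
    · rw [eval_bind₁_chartPoly, h.eval_localEquation]
    · rw [eval_bind₁_chartPoly, map_mul, eval_gammaAt]
      refine mul_ne_zero hn₀ ?_
      split_ifs with hc
      · simp
      · rw [eval_xiAt, h.eval_compXi]
        exact mul_ne_zero hc hn₀
  have hcard := card_le_topologicalKrullDim_add_card isInducing_chart f _ hmaps hne
  rw [card_chartVar, card_localEquation, add_comm 5 m, Nat.cast_add, ← add_assoc] at hcard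
  exact (ENat.WithBot.add_le_add_natCast_right_iff (c := 5)).1 (hcard.trans' (by norm_num))

theorem IsKruppaSolution.seven_le_topologicalKrullDim_add (h : IsKruppaSolution φ₁ φ₂ c v)
    (hφ₁ : φ₁.IsHomogeneous m) (hφ₂ : φ₂.IsHomogeneous m)
    (hγ : compGamma φ₁ (epipole₁ v) ≠ 0) {V : Set Triple}
    (hV : ∀ t c', (c' = 0 → c = 0) → IsKruppaSolution φ₁ φ₂ c' t.coords → t ∈ V) :
    (7 : WithBot ℕ∞) ≤ topologicalKrullDim V + (m : WithBot ℕ∞) := by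
  obtain ⟨i, k, j, x, c', hc', hx, hγx⟩ := h.exists_chartCoords hφ₁ hφ₂ hγ
  exact hx.seven_le_topologicalKrullDim_add_of_chartCoords hφ₁ hφ₂ hγx fun t d hd ht =>
    hV t d (hc'.1 ∘ hd) ht

end KruppaSolutions

section LinearForm

variable {σ K : Type*} [Fintype σ] [Field K]

/-- The linear form with coefficients `l`. -/
noncomputable def linearForm (l : σ → K) : MvPolynomial σ K :=
  ∑ s, C (l s) * X s

theorem eval_linearForm (l p : σ → K) : eval p (linearForm l) = l ⬝ᵥ p := by
  simp [linearForm, dotProduct]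

theorem isHomogeneous_linearForm (l : σ → K) : (linearForm l).IsHomogeneous 1 :=
  .sum _ _ _ fun _ _ => isHomogeneous_C_mul_X _ _

theorem exists_eq_linearForm {φ : MvPolynomial σ K} (h : φ.IsHomogeneous 1) :
    ∃ l, φ = linearForm l := by
  have hmem : φ ∈ homogeneousSubmodule σ K 1 := h
  rw [homogeneousSubmodule_one_eq_span_X, Submodule.mem_span_range_iff_exists_fun] at hmem
  obtain ⟨l, rfl⟩ := hmem
  exact ⟨l, by simp only [linearForm, smul_eq_C_mul]⟩

theorem exists_dotProduct_eq_one {l : σ → K} (hl : l ≠ 0) : ∃ w, l ⬝ᵥ w = 1 := by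
  classical
  obtain ⟨s, hs⟩ := Function.ne_iff.1 hl
  exact ⟨Pi.single s (l s)⁻¹, by rw [dotProduct_single, mul_inv_cancel₀ hs]⟩

theorem linearForm_dvd [Infinite K] {φ : MvPolynomial σ K} {l : σ → K} (hl : l ≠ 0)
    (h : ∀ u, l ⬝ᵥ u = 0 → eval u φ = 0) : linearForm l ∣ φ := by
  obtain ⟨w, hw⟩ := exists_dotProduct_eq_one hl
  -- Substituting the projection `p ↦ p - (l ⬝ᵥ p) w` to the hyperplane does not affect `φ` modulo
  -- the linear form, and it turns `φ` into a polynomial without non-zero values.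
  let s (a : σ) : MvPolynomial σ K := X a - C (w a) * linearForm l
  have hzero : bind₁ s φ = 0 := by
    refine MvPolynomial.funext fun p => ?_
    have hs : (fun a => eval p (s a)) = p - (l ⬝ᵥ p) • w := by
      ext a
      simp [s, eval_linearForm, mul_comm]
    rw [eval_bind₁, map_zero, hs]
    exact h _ (by rw [dotProduct_sub, dotProduct_smul, hw, smul_eq_mul, mul_one, sub_self])
  let π := Ideal.Quotient.mkₐ K (Ideal.span {linearForm l})
  have hπ : π.comp (bind₁ s) = π := by
    ext a
    have hker : π (linearForm l) = 0 := Ideal.Quotient.eq_zero_iff_mem.2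
      (Ideal.mem_span_singleton_self _)
    simp [s, hker]
  rw [← Ideal.mem_span_singleton, ← Ideal.Quotient.eq_zero_iff_mem]
  exact (DFunLike.congr_fun hπ φ).symm.trans (by rw [AlgHom.comp_apply, hzero, map_zero])

theorem degree_eq_one_of_forall_eval_eq_zero [Infinite K] {φ : MvPolynomial σ K} {m : ℕ}
    (hφ : φ.IsHomogeneous m) (hirr : Irreducible φ) {l : σ → K} (hl : l ≠ 0)
    (h : ∀ u, l ⬝ᵥ u = 0 → eval u φ = 0) : m = 1 := by
  obtain ⟨q, hq⟩ := linearForm_dvd hl h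
  have hnonunit : ¬IsUnit (linearForm l) := fun hunit => by
    have := hunit.map (eval (0 : σ → K))
    rw [eval_linearForm, dotProduct_zero] at this
    exact not_isUnit_zero this
  have hunit : IsUnit q := (hirr.isUnit_or_isUnit hq).resolve_left hnonunit
  have hne : linearForm l ≠ 0 := left_ne_zero_of_mul (hq ▸ hirr.ne_zero)
  rw [← hφ.totalDegree hirr.ne_zero, hq, totalDegree_mul_of_isDomain hne hunit.ne_zero,
    (isUnit_iff_totalDegree_of_isReduced.1 hunit).2, (isHomogeneous_linearForm l).totalDegree hne]

end LinearForm

section DegenerateEpipole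

variable {φ₁ φ₂ : MvPolynomial (Fin 3) ℂ} {m : ℕ}

theorem eval_eq_zero_of_compGamma_eq_zero {φ : MvPolynomial (Fin 3) ℂ} {e u : Fin 3 → ℂ}
    (he : e ≠ 0) (h : compGamma φ e = 0) (hu : e ⬝ᵥ u = 0) : eval u φ = 0 := by
  obtain ⟨w, hw⟩ := exists_dotProduct_eq_one he
  have hcross : e ⨯₃ (u ⨯₃ w) = u := by
    rw [cross_cross_eq_smul_sub_smul', hw, dotProduct_comm u, hu, one_smul, zero_smul, sub_zero]
  rw [← hcross, ← eval_compGamma, h, map_zero]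

theorem exists_cross_ne_zero {K : Type*} [Field K] {l : Fin 3 → K} (hl : l ≠ 0) :
    ∃ e, l ⨯₃ e ≠ 0 := by
  obtain ⟨i, hi⟩ := Function.ne_iff.1 hl
  refine ⟨Pi.single (i + 1) 1, fun h => hi ?_⟩
  have := congrFun h (i + 2)
  fin_cases i <;> simpa [cross_apply] using this

theorem exists_isKruppaSolution_of_isHomogeneous_one (h₁ : φ₁.IsHomogeneous 1)
    (h₂ : φ₂.IsHomogeneous 1) (hne₁ : φ₁ ≠ 0) (hne₂ : φ₂ ≠ 0) :
    ∃ v, IsKruppaSolution φ₁ φ₂ 1 v ∧ compGamma φ₁ (epipole₁ v) ≠ 0 := by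
  obtain ⟨l₁, rfl⟩ := exists_eq_linearForm h₁
  obtain ⟨l₂, rfl⟩ := exists_eq_linearForm h₂
  have hl₁ : l₁ ≠ 0 := by rintro rfl; simp [linearForm] at hne₁
  have hl₂ : l₂ ≠ 0 := by rintro rfl; simp [linearForm] at hne₂
  obtain ⟨e, hu⟩ := exists_cross_ne_zero hl₁
  obtain ⟨w, hw⟩ := exists_dotProduct_eq_one hl₂
  obtain ⟨e', he', he'w⟩ := exists_ne_zero_dotProduct_eq_zero w
  -- `l₁ ⬝ᵥ (e × p) = (l₁ × e) ⬝ᵥ p`, so the rank one matrix `w (l₁ × e)ᵀ` solves the equation.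
  let F := Matrix.vecMulVec w (l₁ ⨯₃ e)
  have hγ (p : Fin 3 → ℂ) : eval p (compGamma (linearForm l₁) e) = (l₁ ⨯₃ e) ⬝ᵥ p := by
    rw [eval_compGamma, eval_linearForm, triple_product_permutation, triple_product_permutation,
      dotProduct_comm]
  refine ⟨Sum.elim e (Sum.elim (fun a => F a.1 a.2) e'), ⟨?_, ?_, he', ?_, ?_, ?_⟩, ?_⟩
  · rintro (rfl : e = 0)
    exact hu (map_zero _)
  · refine Matrix.vecMulVec_ne_zero (fun hzero => ?_) hu
    simp [hzero] at hw
  · change F *ᵥ e = 0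
    rw [Matrix.vecMulVec_mulVec, dotProduct_comm, dot_cross_self, MulOpposite.op_zero, zero_smul]
  · change e' ᵥ* F = 0
    rw [Matrix.vecMul_vecMulVec, he'w, zero_smul]
  · change compXi _ F = C 1 * compGamma _ e
    refine MvPolynomial.funext fun p => ?_
    rw [C_1, one_mul, hγ, eval_compXi, eval_linearForm, Matrix.vecMulVec_mulVec, op_smul_eq_smul,
      dotProduct_smul, hw, smul_eq_mul, mul_one]
  · change compGamma _ e ≠ 0
    obtain ⟨p, hp⟩ := exists_dotProduct_eq_one hu
    intro hzero
    simpa [hzero, hp] using hγ p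

theorem exists_isKruppaSolution_of_compGamma_eq_zero (hφ₁ : φ₁.IsHomogeneous m)
    (hφ₂ : φ₂.IsHomogeneous m) (hirr₁ : Irreducible φ₁) (hne₂ : φ₂ ≠ 0) {e : Fin 3 → ℂ}
    (he : e ≠ 0) (h : compGamma φ₁ e = 0) :
    ∃ v, IsKruppaSolution φ₁ φ₂ 1 v ∧ compGamma φ₁ (epipole₁ v) ≠ 0 := by
  obtain rfl : m = 1 := degree_eq_one_of_forall_eval_eq_zero hφ₁ hirr₁ he fun _ =>
    eval_eq_zero_of_compGamma_eq_zero he h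
  exact exists_isKruppaSolution_of_isHomogeneous_one hφ₁ hφ₂ hirr₁.ne_zero hne₂

end DegenerateEpipole

section Elimination

variable {φ₁ φ₂ : MvPolynomial (Fin 3) ℂ} {t : Triple}

theorem KruppaEquations.exists_eq_C_mul (h : KruppaEquations φ₁ φ₂ t)
    (hγ : compGamma φ₁ t.e₁.coords ≠ 0) :
    ∃ c, compXi φ₂ t.F.matrix = C c * compGamma φ₁ t.e₁.coords := by
  obtain ⟨β, hβ⟩ := ne_zero_iff.1 hγ
  refine ⟨coeff β (compXi φ₂ t.F.matrix) / coeff β (compGamma φ₁ t.e₁.coords), ?_⟩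
  ext α
  rw [coeff_C_mul, div_mul_eq_mul_div, eq_div_iff hβ]
  exact h α β

theorem kruppaEquations_of_eq_C_mul {c : ℂ}
    (h : compXi φ₂ t.F.matrix = C c * compGamma φ₁ t.e₁.coords) : KruppaEquations φ₁ φ₂ t := by
  intro α β
  rw [h, coeff_C_mul, coeff_C_mul]
  ring

end Elimination

section NonDegenerateSolutions

variable {φ₁ φ₂ : MvPolynomial (Fin 3) ℂ} {m : ℕ} {t : Triple}

theorem exists_isKruppaSolution_of_mem_kruppaVariety (hφ₁ : φ₁.IsHomogeneous m)
    (hφ₂ : φ₂.IsHomogeneous m) (hirr₁ : Irreducible φ₁) (hne₂ : φ₂ ≠ 0)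
    (ht : t ∈ kruppaVariety φ₁ φ₂) :
    ∃ c v, IsKruppaSolution φ₁ φ₂ c v ∧ compGamma φ₁ (epipole₁ v) ≠ 0 := by
  by_cases hγ : compGamma φ₁ t.e₁.coords = 0
  · exact ⟨1, exists_isKruppaSolution_of_compGamma_eq_zero hφ₁ hφ₂ hirr₁ hne₂
      t.e₁.coords_ne_zero hγ⟩
  · obtain ⟨c, hc⟩ := ht.1.exists_eq_C_mul hγ
    exact ⟨c, t.coords, isKruppaSolution_coords_iff.2 ⟨hc, ht.2⟩, hγ⟩

theorem exists_isKruppaSolution_of_mem_kruppaSolutions (hφ₁ : φ₁.IsHomogeneous m)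
    (hφ₂ : φ₂.IsHomogeneous m) (hirr₁ : Irreducible φ₁) (hne₂ : φ₂ ≠ 0)
    (ht : t ∈ kruppaSolutions φ₁ φ₂) :
    ∃ c v, c ≠ 0 ∧ IsKruppaSolution φ₁ φ₂ c v ∧ compGamma φ₁ (epipole₁ v) ≠ 0 := by
  by_cases hγ : compGamma φ₁ t.e₁.coords = 0
  · obtain ⟨v, hv⟩ := exists_isKruppaSolution_of_compGamma_eq_zero hφ₁ hφ₂ hirr₁ hne₂
      t.e₁.coords_ne_zero hγ
    exact ⟨1, v, one_ne_zero, hv⟩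
  · obtain ⟨⟨c, hc0, hc⟩, htE⟩ := ht
    exact ⟨c, t.coords, hc0, isKruppaSolution_coords_iff.2 ⟨hc, htE⟩, hγ⟩

end NonDegenerateSolutions

end Kruppa

open Kruppa in
theorem mainTheorem7_general {φ₁ φ₂ : MvPolynomial (Fin 3) ℂ} {m : ℕ} (hφ₁ : φ₁.IsHomogeneous m)
    (hφ₂ : φ₂.IsHomogeneous m) (hirr₁ : Irreducible φ₁) (hne₂ : φ₂ ≠ 0) :
    ((kruppaVariety φ₁ φ₂).Nonempty →
      (7 : WithBot ℕ∞) ≤ topologicalKrullDim (kruppaVariety φ₁ φ₂) + (m : WithBot ℕ∞)) ∧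
    ((kruppaSolutions φ₁ φ₂).Nonempty →
      (7 : WithBot ℕ∞) ≤ topologicalKrullDim (kruppaSolutions φ₁ φ₂) + (m : WithBot ℕ∞)) := by
  constructor
  · rintro ⟨t, ht⟩
    obtain ⟨c, v, hv, hγ⟩ :=
      exists_isKruppaSolution_of_mem_kruppaVariety hφ₁ hφ₂ hirr₁ hne₂ ht
    refine hv.seven_le_topologicalKrullDim_add hφ₁ hφ₂ hγ fun t' c' _ ht' => ?_
    obtain ⟨hc', htE⟩ := isKruppaSolution_coords_iff.1 ht'
    exact ⟨kruppaEquations_of_eq_C_mul hc', htE⟩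
  · rintro ⟨t, ht⟩
    obtain ⟨c, v, hc, hv, hγ⟩ :=
      exists_isKruppaSolution_of_mem_kruppaSolutions hφ₁ hφ₂ hirr₁ hne₂ ht
    refine hv.seven_le_topologicalKrullDim_add hφ₁ hφ₂ hγ fun t' c' hcc' ht' => ?_
    obtain ⟨hc', htE⟩ := isKruppaSolution_coords_iff.1 ht'
    exact ⟨⟨c', mt hcc' hc, hc'⟩, htE⟩

theorem mainTheorem7
    (X : Set Kruppa.P3) (hX : Kruppa.IsSpaceCurve X)
    (M₁ M₂ : Matrix (Fin 3) (Fin 4) ℂ) (hM₁ : M₁.rank = 3) (hM₂ : M₂.rank = 3)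
    (hO₁ : ∀ P ∈ X, M₁.mulVec P.coords ≠ 0) (hO₂ : ∀ P ∈ X, M₂.mulVec P.coords ≠ 0)
    (f₁ f₂ φ₁ φ₂ : MvPolynomial (Fin 3) ℂ) (d₁ d₂ m : ℕ)
    (hf₁ : Kruppa.IsEquation f₁ d₁ (Kruppa.projection M₁ X))
    (hf₂ : Kruppa.IsEquation f₂ d₂ (Kruppa.projection M₂ X))
    (hφ₁ : Kruppa.IsEquation φ₁ m (Kruppa.dualCurve f₁))
    (hφ₂ : Kruppa.IsEquation φ₂ m (Kruppa.dualCurve f₂)) :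
    ((Kruppa.kruppaVariety φ₁ φ₂).Nonempty →
      (7 : WithBot ℕ∞) ≤ topologicalKrullDim (Kruppa.kruppaVariety φ₁ φ₂) + (m : WithBot ℕ∞)) ∧
    ((Kruppa.kruppaSolutions φ₁ φ₂).Nonempty →
      (7 : WithBot ℕ∞) ≤
        topologicalKrullDim (Kruppa.kruppaSolutions φ₁ φ₂) + (m : WithBot ℕ∞)) :=
  mainTheorem7_general hφ₁.1 hφ₂.1 hφ₁.2.1 hφ₂.2.1.ne_zero
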